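/- All vector spaces are real. A \emph{Banach sequence lattice} is a linear subspace $Y\subset\mathbb R^{\mathbb N}$ with a complete norm $\|\cdot\|_Y$ such that $Y$ contains every canonical sequence $e_k$, and whenever $f\in\mathbb R^{\mathbb N}$, $g\in Y$ and $|f|\le|g|$ pointwise, then $f\in Y$ and $\|f\|_Y\le\|g\|_Y$. For $t\in\mathbb R^n$ write $\|t\|_{\mathbb R^n,Y}=\|(t_1,\dots,t_n,0,0,\dots)\|_Y$. Let $\mathcal H_n$ be the vector lattice of continuous functions $h:\mathbb R^n\to\mathbb R$ with $h(\lambda t)=\lambda h(t)$ for all $\lambda\ge0$ and $t\in\mathbb R^n$. For a Banach lattice $X$ and $x=(x_1,\dots,x_n)\in X^n$ let $\tau_{n,x}:\mathcal H_n\to X$ be Krivine's functional calculus: the unique linear map with $\tau_{n,x}(h_1\vee h_2)=\tau_{n,x}(h_1)\vee\tau_{n,x}(h_2)$ for all $h_1,h_2\in\mathcal H_n$ that sends the $j$-th coordinate projection to $x_j$, $1\le j\le n$. Put $$\|x\|_{X^n,Y,\tau}=\big\|\tau_{n,x}(\|\cdot\|_{\mathbb R^n,Y})\big\|_X ,\qquad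 \|w\|_{E^n,Y}=\big\|(\|w_1\|_E,\dots,\|w_n\|_E)\big\|_{\mathbb R^n,Y}$$ for $x\in X^n$ and for $w\in E^n$, where $E$ is a Banach space. Let $Y$ be a Banach sequence lattice, $E,F$ Banach spaces and $X,W$ Banach lattices. \begin{itemize} \item A linear operator $T:E\to X$ is \emph{$Y$-convex}, $T\in\mathcal K^Y(E,X)$, if there is $C>0$ with $\|(Tw_1,\dots,Tw_n)\|_{X^n,Y,\tau}\le C\|(w_1,\dots,w_n)\|_{E^n,Y}$ for all $n$ and $w_1,\dots,w_n\in E$. \item A linear operator $S:X\to E$ is \emph{$Y$-concave}, $S\in\mathcal K_Y(X,E)$, if there is $C>0$ with $\|(Sx_1,\dots,Sx_n)\|_{E^n,Y}\le C\|(x_1,\dots,x_n)\|_{X^n,Y,\tau}$ for all $n$ and $x_1,\dots,x_n\in X$. \item A linear operator $L:X\to W$ is \emph{$Y$-regular}, $L\in\Lambda_Y(X,W)$, if there is $C>0$ with $\|(Lx_1,\dots,Lx_n)\|_{W^n,Y,\tau}\le C\|(x_1,\dots,x_n)\|_{X^n,Y,\tau}$ for all $n$ and $x_1,\dots,x_n\in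 X$. \end{itemize} The smallest constants $C\ge0$ in these inequalities are denoted by $\|T\|_{\mathcal K^Y}$, $\|S\|_{\mathcal K_Y}$ and $\|L\|_{\Lambda_Y}$. Write $\mathcal L(\cdot,\cdot)$ for the bounded linear operators, with the operator norm $\|\cdot\|$. \textbf{Proposition.} (i) If $R\in\mathcal L(F,E)$ and $T\in\mathcal K^Y(E,X)$, then $T\circ R\in\mathcal K^Y(F,X)$ and $\|T\circ R\|_{\mathcal K^Y}\le\|T\|_{\mathcal K^Y}\|R\|$. (ii) If $T\in\mathcal K^Y(E,X)$ and $L\in\Lambda_Y(X,W)$, then $L\circ T\in\mathcal K^Y(E,W)$ and $\|L\circ T\|_{\mathcal K^Y}\le\|L\|_{\Lambda_Y}\|T\|_{\mathcal K^Y}$. (iii) If $S\in\mathcal K_Y(X,E)$ and $R\in\mathcal L(E,F)$, then $R\circ S\in\mathcal K_Y(X,F)$ and $\|R\circ S\|_{\mathcal K_Y}\le\|R\|\,\|S\|_{\mathcal K_Y}$. (iv) If $L\in\Lambda_Y(X,W)$ and $S\in\mathcal K_Y(W,E)$, then $S\circ L\in\mathcal K_Y(X,E)$ and $\|S\circ L\|_{\mathcal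 K_Y}\le\|S\|_{\mathcal K_Y}\|L\|_{\Lambda_Y}$. -/

import Mathlib

open Filter Topology

set_option linter.unusedSectionVars false

/-! ### Continuous positively homogeneous functions on `ℝⁿ` -/

/-- The space `𝓗ₙ` of continuous functions `h : ℝⁿ → ℝ` that are homogeneous of degree `1`,
i.e. `h (c t) = c h t` for all `c ≥ 0`. -/
def HomogFun (n : ℕ) : Submodule ℝ C(Fin n → ℝ, ℝ) where
  carrier := {h | ∀ c : ℝ, 0 ≤ c → ∀ t : Fin n → ℝ, h (c • t) = c * h t}
  add_mem' := by
    intro f g hf hg c hc t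
    simp only [ContinuousMap.add_apply, hf c hc t, hg c hc t, mul_add]
  zero_mem' := by
    intro c _ t
    simp
  smul_mem' := by
    intro a f hf c hc t
    simp only [ContinuousMap.smul_apply, hf c hc t, smul_eq_mul]
    ring

namespace HomogFun

/-- `𝓗ₙ` with the pointwise order and the pointwise lattice operations. -/
instance (n : ℕ) : Lattice (HomogFun n) :=
  Subtype.lattice
    (by
      intro f g hf hg c hc t
      simp only [ContinuousMap.sup_apply, hf c hc t, hg c hc t, mul_max_of_nonneg _ _ hc])
    (by
      intro f g hf hg c hc t
      simp only [ContinuousMap.inf_apply, hf c hc t, hg c hc t, mul_min_of_nonneg _ _ hc])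

/-- The coordinate projection `π_{n,j} ∈ 𝓗ₙ`. -/
def proj {n : ℕ} (j : Fin n) : HomogFun n :=
  ⟨⟨fun t => t j, continuous_apply j⟩, by intro c _ t; simp⟩

end HomogFun

/-! ### Krivine's functional calculus -/

/-- `τ : 𝓗ₙ → X` is a Krivine functional calculus at `x = (x₁, …, xₙ) ∈ Xⁿ`: it is linear,
maps the `j`-th coordinate projection to `xⱼ` and preserves finite suprema. -/
structure IsKrivineCalculus {X : Type*} [AddCommGroup X] [Module ℝ X] [Lattice X] {n : ℕ}
    (x : Fin n → X) (τ : HomogFun n →ₗ[ℝ] X) : Prop where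
  map_proj : ∀ j, τ (HomogFun.proj j) = x j
  map_sup : ∀ h₁ h₂, τ (h₁ ⊔ h₂) = τ h₁ ⊔ τ h₂

/-! The next section proves that the Krivine functional calculus exists and is unique on every
Banach lattice. -/

namespace Krivine

section Algebra

variable {Z : Type*} [AddCommGroup Z] [Module ℝ Z] [Lattice Z] [IsOrderedAddMonoid Z]
  [IsOrderedModule ℝ Z] {n : ℕ}

/-- The finite supremum `⋁_{a ∈ s} ∑ⱼ aⱼ zⱼ`. -/
def supLin (z : Fin n → Z) (s : Finset (Fin n → ℝ)) (hs : s.Nonempty) : Z :=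
  s.sup' hs (fun a => ∑ j, a j • z j)

open scoped Classical Pointwise in
theorem supLin_add (z : Fin n → Z) {s u : Finset (Fin n → ℝ)} (hs : s.Nonempty)
    (hu : u.Nonempty) :
    supLin z (s + u) (hs.add hu) = supLin z s hs + supLin z u hu := by
  unfold supLin
  apply le_antisymm
  · refine Finset.sup'_le _ _ fun c hc => ?_
    obtain ⟨a, ha, b, hb, rfl⟩ := Finset.mem_add.1 hc
    have h1 := Finset.le_sup' (fun a : Fin n → ℝ => ∑ j, a j • z j) ha
    have h2 := Finset.le_sup' (fun a : Fin n → ℝ => ∑ j, a j • z j) hb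
    refine le_trans (le_of_eq ?_) (add_le_add h1 h2)
    simp [add_smul, Finset.sum_add_distrib]
  · rw [← le_sub_iff_add_le]
    refine Finset.sup'_le _ _ fun a ha => ?_
    rw [le_sub_iff_add_le, ← le_sub_iff_add_le']
    refine Finset.sup'_le _ _ fun b hb => ?_
    rw [le_sub_iff_add_le']
    refine le_trans (le_of_eq ?_)
      (Finset.le_sup' (fun a : Fin n → ℝ => ∑ j, a j • z j) (Finset.add_mem_add ha hb))
    simp [add_smul, Finset.sum_add_distrib]

open scoped Classical in
theorem supLin_union (z : Fin n → Z) {s u : Finset (Fin n → ℝ)} (hs : s.Nonempty)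
    (hu : u.Nonempty) :
    supLin z (s ∪ u) (hs.mono Finset.subset_union_left) = supLin z s hs ⊔ supLin z u hu :=
  Finset.sup'_union hs hu _

open scoped Classical in
theorem supLin_smul (z : Fin n → Z) {s : Finset (Fin n → ℝ)} (hs : s.Nonempty) {c : ℝ}
    (hc : 0 < c) :
    supLin z (s.image (c • ·)) (hs.image _) = c • supLin z s hs := by
  unfold supLin
  apply le_antisymm
  · refine Finset.sup'_le _ _ fun b hb => ?_
    obtain ⟨a, ha, rfl⟩ := Finset.mem_image.1 hb
    refine le_trans (le_of_eq ?_) (smul_le_smul_of_nonneg_left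
      (Finset.le_sup' (fun a : Fin n → ℝ => ∑ j, a j • z j) ha) hc.le)
    simp [Finset.smul_sum, smul_smul]
  · have : s.sup' hs (fun a => ∑ j, a j • z j) ≤
        c⁻¹ • (s.image (c • ·)).sup' (hs.image _) (fun a => ∑ j, a j • z j) := by
      refine Finset.sup'_le _ _ fun a ha => ?_
      refine le_trans (le_of_eq ?_) (smul_le_smul_of_nonneg_left
        (Finset.le_sup' (fun a : Fin n → ℝ => ∑ j, a j • z j)
          (Finset.mem_image_of_mem (c • ·) ha)) (inv_nonneg.2 hc.le))
      simp [Finset.smul_sum, smul_smul, hc.ne']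
    have h2 := smul_le_smul_of_nonneg_left this hc.le
    rwa [smul_smul, mul_inv_cancel₀ hc.ne', one_smul] at h2

theorem supLin_mono (z : Fin n → Z) {s u : Finset (Fin n → ℝ)} (hs : s.Nonempty)
    (hu : u.Nonempty) (h : ∀ t : Fin n → ℝ, supLin t s hs ≤ supLin t u hu) :
    supLin z s hs ≤ supLin z u hu := by
  refine Finset.sup'_le _ _ fun a ha => ?_
  have hmem : a ∈ convexHull ℝ (u : Set (Fin n → ℝ)) := by
    by_contra hcon
    obtain ⟨f, r, hf, hr⟩ := geometric_hahn_banach_closed_point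
      (convex_convexHull ℝ (u : Set (Fin n → ℝ))) (u.finite_toSet.isClosed_convexHull ℝ) hcon
    have hrep : ∀ b : Fin n → ℝ, f b = ∑ j, b j • f (Pi.single j 1) := by
      intro b
      conv_lhs => rw [pi_eq_sum_univ' b]
      simp [map_sum]
    have h1 := h fun j => f (Pi.single j 1)
    have h2 : f a ≤ supLin (fun j => f (Pi.single j 1)) s hs := by
      rw [hrep a]
      exact Finset.le_sup' (fun a : Fin n → ℝ => ∑ j, a j • f (Pi.single j 1)) ha
    have h3 : supLin (fun j => f (Pi.single j 1)) u hu ≤ r := by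
      refine Finset.sup'_le _ _ fun b hb => ?_
      rw [← hrep b]
      exact (hf b (subset_convexHull ℝ _ hb)).le
    linarith
  let φ : (Fin n → ℝ) →ₗ[ℝ] Z :=
    { toFun := fun a => ∑ j, a j • z j
      map_add' := by intro a b; simp [add_smul, Finset.sum_add_distrib]
      map_smul' := by intro c b; simp [Finset.smul_sum, smul_smul] }
  have hconv : Convex ℝ (φ ⁻¹' Set.Iic (supLin z u hu)) :=
    (convex_Iic (𝕜 := ℝ) (supLin z u hu)).linear_preimage φ
  exact convexHull_min
    (fun b hb => Finset.le_sup' (fun a : Fin n → ℝ => ∑ j, a j • z j) hb) hconv hmem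

/-- `f` is a difference of finite suprema of linear forms, and `y` is the same expression
evaluated at `z`. -/
def Rep (z : Fin n → Z) (f : (Fin n → ℝ) → ℝ) (y : Z) : Prop :=
  ∃ (s u : Finset (Fin n → ℝ)) (hs : s.Nonempty) (hu : u.Nonempty),
    (∀ t, f t = supLin t s hs - supLin t u hu) ∧ y = supLin z s hs - supLin z u hu

theorem supLin_singleton (z : Fin n → Z) (a : Fin n → ℝ) :
    supLin z {a} (Finset.singleton_nonempty a) = ∑ j, a j • z j := by
  simp [supLin]

theorem Rep.zero (z : Fin n → Z) : Rep z (fun _ => 0) 0 :=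
  ⟨{0}, {0}, Finset.singleton_nonempty 0, Finset.singleton_nonempty 0, by simp, by simp⟩

theorem Rep.coord (z : Fin n → Z) (j : Fin n) : Rep z (fun t => t j) (z j) := by
  refine ⟨{Pi.single j 1}, {0}, Finset.singleton_nonempty _, Finset.singleton_nonempty 0, ?_, ?_⟩
  · intro t
    simp [supLin_singleton, Pi.single_apply]
  · simp [supLin_singleton, Pi.single_apply]

theorem Rep.add {z : Fin n → Z} {f g : (Fin n → ℝ) → ℝ} {y w : Z} (hf : Rep z f y)
    (hg : Rep z g w) : Rep z (fun t => f t + g t) (y + w) := by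
  classical
  obtain ⟨s, u, hs, hu, h1, rfl⟩ := hf
  obtain ⟨s', u', hs', hu', h1', rfl⟩ := hg
  open scoped Pointwise in
  refine ⟨s + s', u + u', hs.add hs', hu.add hu', fun t => ?_, ?_⟩
  · beta_reduce
    rw [h1, h1', supLin_add t hs hs', supLin_add t hu hu']; ring
  · rw [supLin_add z hs hs', supLin_add z hu hu']; abel

theorem Rep.neg {z : Fin n → Z} {f : (Fin n → ℝ) → ℝ} {y : Z} (hf : Rep z f y) :
    Rep z (fun t => - f t) (-y) := by
  obtain ⟨s, u, hs, hu, h1, rfl⟩ := hf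
  exact ⟨u, s, hu, hs, fun t => by beta_reduce; rw [h1]; ring, by abel⟩

theorem Rep.smul {z : Fin n → Z} {f : (Fin n → ℝ) → ℝ} {y : Z} (hf : Rep z f y) (c : ℝ) :
    Rep z (fun t => c * f t) (c • y) := by
  classical
  have key : ∀ {f : (Fin n → ℝ) → ℝ} {y : Z} (_ : Rep z f y) (c : ℝ) (_ : 0 < c),
      Rep z (fun t => c * f t) (c • y) := by
    rintro f y ⟨s, u, hs, hu, h1, rfl⟩ c hc
    refine ⟨s.image (c • ·), u.image (c • ·), hs.image _, hu.image _, fun t => ?_, ?_⟩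
    · beta_reduce
      rw [supLin_smul t hs hc, supLin_smul t hu hc, h1, smul_eq_mul, smul_eq_mul]; ring
    · rw [supLin_smul z hs hc, supLin_smul z hu hc, smul_sub]
  rcases lt_trichotomy c 0 with hc | rfl | hc
  · have := (key hf (-c) (by linarith)).neg
    simpa using this
  · simpa using Rep.zero z
  · exact key hf c hc

theorem sub_sup_sub {V : Type*} [AddCommGroup V] [Lattice V] [IsOrderedAddMonoid V]
    (a b c d : V) : (a - b) ⊔ (c - d) = (a + d) ⊔ (c + b) - (b + d) := by
  rw [sub_eq_add_neg _ (b + d), sup_add]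
  congr 1 <;> abel

theorem Rep.sup {z : Fin n → Z} {f g : (Fin n → ℝ) → ℝ} {y w : Z} (hf : Rep z f y)
    (hg : Rep z g w) : Rep z (fun t => f t ⊔ g t) (y ⊔ w) := by
  classical
  obtain ⟨s, u, hs, hu, h1, rfl⟩ := hf
  obtain ⟨s', u', hs', hu', h1', rfl⟩ := hg
  open scoped Pointwise in
  refine ⟨(s + u') ∪ (s' + u), u + u', (hs.add hu').mono Finset.subset_union_left, hu.add hu',
    fun t => ?_, ?_⟩
  · beta_reduce
    rw [h1, h1', supLin_union t (hs.add hu') (hs'.add hu), supLin_add t hs hu',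
      supLin_add t hs' hu, supLin_add t hu hu']
    exact sub_sup_sub _ _ _ _
  · rw [supLin_union z (hs.add hu') (hs'.add hu), supLin_add z hs hu', supLin_add z hs' hu,
      supLin_add z hu hu']
    exact sub_sup_sub _ _ _ _

theorem Rep.mono {z : Fin n → Z} {f g : (Fin n → ℝ) → ℝ} {y w : Z} (hf : Rep z f y)
    (hg : Rep z g w) (h : ∀ t, f t ≤ g t) : y ≤ w := by
  classical
  obtain ⟨s, u, hs, hu, h1, rfl⟩ := hf
  obtain ⟨s', u', hs', hu', h1', rfl⟩ := hg
  open scoped Pointwise in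
  have := supLin_mono z (hs.add hu') (hs'.add hu) (fun t => by
    rw [supLin_add t hs hu', supLin_add t hs' hu]
    have := h t
    rw [h1, h1'] at this
    linarith)
  rw [supLin_add z hs hu', supLin_add z hs' hu] at this
  rw [sub_le_iff_le_add, sub_add_eq_add_sub, le_sub_iff_add_le]
  exact this

theorem Rep.sub {z : Fin n → Z} {f g : (Fin n → ℝ) → ℝ} {y w : Z} (hf : Rep z f y)
    (hg : Rep z g w) : Rep z (fun t => f t - g t) (y - w) := by
  simpa only [sub_eq_add_neg] using hf.add hg.neg

theorem exists_rep_norm (z : Fin n → Z) : ∃ N : Z, Rep z (fun t => ‖t‖) N := by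
  classical
  let U : Finset (Fin n → ℝ) := insert 0 (Finset.univ.image (fun j => Pi.single j (1 : ℝ)) ∪
    Finset.univ.image (fun j => Pi.single j (-1 : ℝ)))
  have hU : U.Nonempty := Finset.insert_nonempty _ _
  refine ⟨supLin z U hU - supLin z {0} (Finset.singleton_nonempty 0), U, {0}, hU,
    Finset.singleton_nonempty 0, fun t => ?_, rfl⟩
  have h0 : supLin t {0} (Finset.singleton_nonempty 0) = 0 := by simp [supLin_singleton]
  have hle : ∀ a ∈ U, ∑ j, a j • t j ≤ supLin t U hU := fun a ha =>
    Finset.le_sup' (fun a : Fin n → ℝ => ∑ j, a j • t j) ha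
  rw [h0, sub_zero]
  apply le_antisymm
  · have hnn : 0 ≤ supLin t U hU := by simpa using hle 0 (by simp [U])
    refine (pi_norm_le_iff_of_nonneg hnn).2 fun j => ?_
    rw [Real.norm_eq_abs, abs_le']
    constructor
    · have := hle (Pi.single j 1) (by simp [U])
      simpa [Pi.single_apply] using this
    · have := hle (Pi.single j (-1)) (by simp [U])
      simpa [Pi.single_apply] using this
  · refine Finset.sup'_le _ _ fun a ha => ?_
    simp only [U, Finset.mem_insert, Finset.mem_union, Finset.mem_image, Finset.mem_univ,
      true_and] at ha
    rcases ha with rfl | ⟨j, rfl⟩ | ⟨j, rfl⟩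
    · simp
    · have := (le_abs_self (t j)).trans (norm_le_pi_norm t j)
      simpa [Pi.single_apply] using this
    · have := (neg_le_abs (t j)).trans (norm_le_pi_norm t j)
      simpa [Pi.single_apply] using this

theorem Rep.homog {z : Fin n → Z} {f : (Fin n → ℝ) → ℝ} {y : Z} (hf : Rep z f y) {c : ℝ}
    (hc : 0 ≤ c) (t : Fin n → ℝ) : f (c • t) = c * f t := by
  obtain ⟨s, u, hs, hu, h1, -⟩ := hf
  have key : ∀ (s : Finset (Fin n → ℝ)) (hs : s.Nonempty),
      supLin (c • t) s hs = c * supLin t s hs := by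
    intro s hs
    unfold supLin
    rw [Finset.mul₀_sup' hc]
    refine Finset.sup'_congr _ rfl fun a _ => ?_
    rw [Finset.mul_sum]
    refine Finset.sum_congr rfl fun j _ => ?_
    simp only [Pi.smul_apply, smul_eq_mul]; ring
  rw [h1, h1, key, key]; ring

theorem Rep.continuous {z : Fin n → Z} {f : (Fin n → ℝ) → ℝ} {y : Z} (hf : Rep z f y) :
    Continuous f := by
  obtain ⟨s, u, hs, hu, h1, -⟩ := hf
  have key : ∀ (s : Finset (Fin n → ℝ)) (hs : s.Nonempty),
      Continuous fun t : Fin n → ℝ => supLin t s hs := by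
    intro s hs
    unfold supLin
    exact Continuous.finset_sup'_apply hs fun a _ => by fun_prop
  rw [funext h1]
  exact (key s hs).sub (key u hu)

/-- The element of `𝓗ₙ` given by a representable function. -/
def Rep.toHomogFun {z : Fin n → Z} {f : (Fin n → ℝ) → ℝ} {y : Z} (hf : Rep z f y) :
    HomogFun n :=
  ⟨⟨f, hf.continuous⟩, fun _ hc t => hf.homog hc t⟩

/-- Finite suprema of linear forms are uniformly dense in `𝓗ₙ` (with respect to the supremum
norm on the unit sphere). -/
theorem exists_rep_near (z : Fin n → Z) (h : HomogFun n) {ε : ℝ} (hε : 0 < ε) :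
    ∃ f y, Rep z f y ∧ ∀ t, |h.1 t - f t| ≤ ε * ‖t‖ := by
  classical
  let K := Metric.sphere (0 : Fin n → ℝ) 1
  let L : Set C(K, ℝ) := {g | ∃ f y, Rep z f y ∧ ∀ t : K, g t = f t}
  obtain ⟨N, hN⟩ := exists_rep_norm z
  have hcl : closure L = ⊤ := by
    refine ContinuousMap.sublattice_closure_eq_top L ⟨0, _, _, Rep.zero z, fun _ => rfl⟩ ?_ ?_ ?_
    · rintro f ⟨f', y, hf, e⟩ g ⟨g', w, hg, e'⟩
      refine ⟨_, _, (hf.neg.sup hg.neg).neg, fun t => ?_⟩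
      simp [e, e', max_neg_neg]
    · rintro f ⟨f', y, hf, e⟩ g ⟨g', w, hg, e'⟩
      exact ⟨_, _, hf.sup hg, fun t => by simp [e, e']⟩
    · intro v a b
      by_cases hab : a = b
      · subst hab
        have hr := hN.smul (v a)
        refine ⟨⟨fun t : K => v a * ‖(t : Fin n → ℝ)‖, by fun_prop⟩, ⟨_, _, hr, fun _ => rfl⟩, ?_⟩
        have : ‖(a : Fin n → ℝ)‖ = 1 := mem_sphere_zero_iff_norm.1 a.2
        simp
      · have hne : (a : Fin n → ℝ) ≠ b := fun e => hab (Subtype.ext e)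
        obtain ⟨j, hj⟩ := Function.ne_iff.1 hne
        have hj' : (a : Fin n → ℝ) j - (b : Fin n → ℝ) j ≠ 0 := sub_ne_zero.2 hj
        let β : ℝ := (v a - v b) / ((a : Fin n → ℝ) j - (b : Fin n → ℝ) j)
        let α : ℝ := v a - β * (a : Fin n → ℝ) j
        have hr := (hN.smul α).add ((Rep.coord z j).smul β)
        refine ⟨⟨fun t : K => α * ‖(t : Fin n → ℝ)‖ + β * (t : Fin n → ℝ) j,
            (continuous_const.mul continuous_subtype_val.norm).add
              (continuous_const.mul ((continuous_apply j).comp continuous_subtype_val))⟩,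
          ⟨_, _, hr, fun _ => rfl⟩, ?_, ?_⟩
        · have : ‖(a : Fin n → ℝ)‖ = 1 := mem_sphere_zero_iff_norm.1 a.2
          simp [α]
        · have : ‖(b : Fin n → ℝ)‖ = 1 := mem_sphere_zero_iff_norm.1 b.2
          simp only [ContinuousMap.coe_mk, this, α, β]
          field_simp
          ring
  let hK : C(K, ℝ) := ⟨fun t => h.1 t, by fun_prop⟩
  have hmem : hK ∈ closure L := by rw [hcl]; trivial
  obtain ⟨g, ⟨f, y, hf, e⟩, hg⟩ := Metric.mem_closure_iff.1 hmem ε hε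
  refine ⟨f, y, hf, fun t => ?_⟩
  have h0h : ∀ c : ℝ, 0 ≤ c → ∀ t, h.1 (c • t) = c * h.1 t := h.2
  by_cases ht : t = 0
  · subst ht
    have e1 := h0h 0 le_rfl 0
    have e2 := hf.homog le_rfl (0 : Fin n → ℝ)
    simp only [smul_zero, zero_mul] at e1 e2
    simp [e1, e2]
  · have hn : ‖t‖ ≠ 0 := norm_ne_zero_iff.2 ht
    have hs : ‖t‖⁻¹ • t ∈ K := by simp [K, norm_smul, hn]
    have hd := (ContinuousMap.dist_apply_le_dist (f := hK) (g := g) ⟨_, hs⟩).trans hg.le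
    rw [Real.dist_eq, e] at hd
    have e0 : t = ‖t‖ • (‖t‖⁻¹ • t) := by rw [smul_smul, mul_inv_cancel₀ hn, one_smul]
    have e1 := h0h ‖t‖ (norm_nonneg t) (‖t‖⁻¹ • t)
    have e2 := hf.homog (norm_nonneg t) (‖t‖⁻¹ • t)
    rw [← e0] at e1 e2
    rw [e1, e2, ← mul_sub, abs_mul, abs_norm, mul_comm]
    exact mul_le_mul_of_nonneg_right hd (norm_nonneg t)

theorem homogFun_le_iff {h₁ h₂ : HomogFun n} : h₁ ≤ h₂ ↔ ∀ t, h₁.1 t ≤ h₂.1 t :=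
  ContinuousMap.le_def

theorem map_supLin {x : Fin n → Z} {τ : HomogFun n →ₗ[ℝ] Z} (hτ : IsKrivineCalculus x τ)
    (s : Finset (Fin n → ℝ)) (hs : s.Nonempty) :
    τ (s.sup' hs fun a => ∑ j, a j • HomogFun.proj j) = supLin x s hs := by
  unfold supLin
  rw [Finset.apply_sup'_eq_sup'_comp hs τ hτ.map_sup]
  refine Finset.sup'_congr _ rfl fun a _ => ?_
  simp [map_sum, hτ.map_proj]

theorem sup'_proj_apply (s : Finset (Fin n → ℝ)) (hs : s.Nonempty) (t : Fin n → ℝ) :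
    (s.sup' hs fun a => ∑ j, a j • HomogFun.proj j).1 t = supLin t s hs := by
  unfold supLin
  rw [Finset.apply_sup'_eq_sup'_comp hs (fun h : HomogFun n => h.1 t) (fun _ _ => rfl)]
  refine Finset.sup'_congr _ rfl fun a _ => ?_
  simp [HomogFun.proj]

theorem Rep.map_eq {x : Fin n → Z} {τ : HomogFun n →ₗ[ℝ] Z} (hτ : IsKrivineCalculus x τ)
    {f : (Fin n → ℝ) → ℝ} {y : Z} (hf : Rep x f y) : τ hf.toHomogFun = y := by
  obtain ⟨s, u, hs, hu, h1, rfl⟩ := id hf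
  have : hf.toHomogFun = (s.sup' hs fun a => ∑ j, a j • HomogFun.proj j) -
      u.sup' hu fun a => ∑ j, a j • HomogFun.proj j := by
    apply Subtype.ext
    ext t
    have e1 := sup'_proj_apply s hs t
    have e2 := sup'_proj_apply u hu t
    change f t = (s.sup' hs fun a => ∑ j, a j • HomogFun.proj j).1 t -
      (u.sup' hu fun a => ∑ j, a j • HomogFun.proj j).1 t
    rw [e1, e2, h1]
  rw [this, map_sub, map_supLin hτ, map_supLin hτ]

end Algebra

section Banach

variable {X : Type*} [NormedAddCommGroup X] [NormedSpace ℝ X] [Lattice X] [HasSolidNorm X]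
  [IsOrderedAddMonoid X] [IsOrderedModule ℝ X] {n : ℕ}

theorem norm_le_of_bounds {y N : X} {c : ℝ} (hc : 0 ≤ c) (h1 : y ≤ c • N) (h2 : -y ≤ c • N) :
    ‖y‖ ≤ c * ‖N‖ := by
  have h3 : |y| ≤ c • N := abs_le'.2 ⟨h1, h2⟩
  have h4 := norm_le_norm_of_abs_le_abs (h3.trans (le_abs_self _))
  rwa [norm_smul, Real.norm_eq_abs, abs_of_nonneg hc] at h4

theorem Rep.norm_le {x : Fin n → X} {f : (Fin n → ℝ) → ℝ} {y N : X} (hf : Rep x f y)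
    (hN : Rep x (fun t => ‖t‖) N) {c : ℝ} (hc : 0 ≤ c) (h : ∀ t, |f t| ≤ c * ‖t‖) :
    ‖y‖ ≤ c * ‖N‖ :=
  norm_le_of_bounds hc (hf.mono (hN.smul c) fun t => (le_abs_self _).trans (h t))
    (hf.neg.mono (hN.smul c) fun t => (neg_le_abs _).trans (h t))

/-- `y` is the limit of the values at `x` of representable functions converging to `h`. -/
def Lim (x : Fin n → X) (h : HomogFun n) (y : X) : Prop :=
  ∀ ε > 0, ∃ f w, Rep x f w ∧ (∀ t, |h.1 t - f t| ≤ ε * ‖t‖) ∧ ‖y - w‖ ≤ ε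

theorem Lim.unique {x : Fin n → X} {h : HomogFun n} {y y' : X} (hy : Lim x h y)
    (hy' : Lim x h y') : y = y' := by
  obtain ⟨N, hN⟩ := exists_rep_norm x
  have key : ∀ ε > 0, ‖y - y'‖ ≤ ε * (2 + 2 * ‖N‖) := by
    intro ε hε
    obtain ⟨f, w, hf, h1, h2⟩ := hy ε hε
    obtain ⟨f', w', hf', h1', h2'⟩ := hy' ε hε
    have h3 : ‖w - w'‖ ≤ (2 * ε) * ‖N‖ := (hf.sub hf').norm_le hN (by positivity) fun t => by
      have := abs_sub_le (f t) (h.1 t) (f' t)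
      have h5 := h1 t
      rw [abs_sub_comm] at h5
      linarith [h1' t]
    have h4 : y - y' = (y - w) + (w - w') - (y' - w') := by abel
    have h6 := norm_sub_le ((y - w) + (w - w')) (y' - w')
    have h7 := norm_add_le (y - w) (w - w')
    rw [h4]
    linarith
  have h0 : ‖y - y'‖ ≤ 0 := by
    refine le_of_forall_pos_le_add fun δ hδ => ?_
    have := key (δ / (2 + 2 * ‖N‖)) (by positivity)
    rw [div_mul_cancel₀ _ (by positivity)] at this
    linarith
  exact sub_eq_zero.1 (norm_le_zero_iff.1 h0)

theorem Lim.add {x : Fin n → X} {h h' : HomogFun n} {y y' : X} (hy : Lim x h y)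
    (hy' : Lim x h' y') : Lim x (h + h') (y + y') := by
  intro ε hε
  obtain ⟨f, w, hf, h1, h2⟩ := hy (ε / 2) (by positivity)
  obtain ⟨f', w', hf', h1', h2'⟩ := hy' (ε / 2) (by positivity)
  refine ⟨_, _, hf.add hf', fun t => ?_, ?_⟩
  · have : (h + h').1 t - (f t + f' t) = (h.1 t - f t) + (h'.1 t - f' t) := by
      simp only [Submodule.coe_add, ContinuousMap.add_apply]; ring
    rw [this]
    have := abs_add_le (h.1 t - f t) (h'.1 t - f' t)
    linarith [h1 t, h1' t]
  · have : y + y' - (w + w') = (y - w) + (y' - w') := by abel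
    rw [this]
    linarith [norm_add_le (y - w) (y' - w')]

theorem Lim.smul {x : Fin n → X} {h : HomogFun n} {y : X} (hy : Lim x h y) (c : ℝ) :
    Lim x (c • h) (c • y) := by
  intro ε hε
  have hc : 0 < |c| + 1 := by positivity
  obtain ⟨f, w, hf, h1, h2⟩ := hy (ε / (|c| + 1)) (by positivity)
  have hb : ∀ r : ℝ, 0 ≤ r → |c| * (ε / (|c| + 1) * r) ≤ ε * r := by
    intro r hr
    have : |c| * (ε / (|c| + 1) * r) = (|c| / (|c| + 1)) * (ε * r) := by field_simp
    rw [this]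
    exact mul_le_of_le_one_left (by positivity) ((div_le_one hc).2 (by linarith))
  refine ⟨_, _, hf.smul c, fun t => ?_, ?_⟩
  · have : (c • h).1 t - c * f t = c * (h.1 t - f t) := by
      simp only [Submodule.coe_smul, ContinuousMap.smul_apply, smul_eq_mul]; ring
    rw [this, abs_mul]
    exact (mul_le_mul_of_nonneg_left (h1 t) (abs_nonneg c)).trans (hb _ (norm_nonneg t))
  · rw [← smul_sub, norm_smul, Real.norm_eq_abs]
    have := (mul_le_mul_of_nonneg_left h2 (abs_nonneg c)).trans
      (le_of_eq (by rw [mul_one])  |>.trans (hb 1 zero_le_one))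
    simpa using this

theorem Lim.sup {x : Fin n → X} {h h' : HomogFun n} {y y' : X} (hy : Lim x h y)
    (hy' : Lim x h' y') : Lim x (h ⊔ h') (y ⊔ y') := by
  intro ε hε
  obtain ⟨f, w, hf, h1, h2⟩ := hy (ε / 2) (by positivity)
  obtain ⟨f', w', hf', h1', h2'⟩ := hy' (ε / 2) (by positivity)
  refine ⟨_, _, hf.sup hf', fun t => ?_, ?_⟩
  · have : (h ⊔ h').1 t = h.1 t ⊔ h'.1 t := rfl
    rw [this]
    have := norm_sup_sub_sup_le_add_norm (h.1 t) (h'.1 t) (f t) (f' t)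
    simp only [Real.norm_eq_abs] at this
    linarith [h1 t, h1' t]
  · linarith [norm_sup_sub_sup_le_add_norm y y' w w']

theorem Rep.lim {x : Fin n → X} {h : HomogFun n} {y : X} (hf : Rep x (fun t => h.1 t) y) :
    Lim x h y := by
  intro ε hε
  refine ⟨_, _, hf, fun t => ?_, ?_⟩
  · simp only [sub_self, abs_zero]; positivity
  · simp only [sub_self, norm_zero]; exact hε.le

theorem exists_lim [CompleteSpace X] (x : Fin n → X) (h : HomogFun n) : ∃ y, Lim x h y := by
  obtain ⟨N, hN⟩ := exists_rep_norm x
  have hpos : ∀ k : ℕ, (0 : ℝ) < (1 / 2) ^ k := fun k => by positivity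
  choose f w hf hfh using fun k : ℕ => exists_rep_near x h (hpos k)
  have hd : ∀ k m : ℕ, ‖w k - w m‖ ≤ ((1 / 2) ^ k + (1 / 2) ^ m) * ‖N‖ := fun k m =>
    ((hf k).sub (hf m)).norm_le hN (by positivity) fun t => by
      have h3 := abs_sub_le (f k t) (h.1 t) (f m t)
      have h4 := hfh k t
      rw [abs_sub_comm] at h4
      linarith [hfh m t]
  have hlim0 : Tendsto (fun k : ℕ => ((1 : ℝ) / 2) ^ k) atTop (𝓝 0) :=
    tendsto_pow_atTop_nhds_zero_of_lt_one (by norm_num) (by norm_num)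
  have hc : CauchySeq w := by
    refine cauchySeq_of_le_tendsto_0 (fun k : ℕ => 2 * (1 / 2) ^ k * ‖N‖) (fun k m K hk hm => ?_) ?_
    · rw [dist_eq_norm]
      refine (hd k m).trans (mul_le_mul_of_nonneg_right ?_ (norm_nonneg N))
      have h1 : ((1 : ℝ) / 2) ^ k ≤ (1 / 2) ^ K :=
        pow_le_pow_of_le_one (by norm_num) (by norm_num) hk
      have h2 : ((1 : ℝ) / 2) ^ m ≤ (1 / 2) ^ K :=
        pow_le_pow_of_le_one (by norm_num) (by norm_num) hm
      linarith
    · simpa using (hlim0.const_mul 2).mul_const ‖N‖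
  obtain ⟨y, hy⟩ := cauchySeq_tendsto_of_complete hc
  refine ⟨y, fun ε hε => ?_⟩
  have e1 : ∀ᶠ k in atTop, ((1 : ℝ) / 2) ^ k < ε := hlim0.eventually (gt_mem_nhds hε)
  have e2 : ∀ᶠ k in atTop, dist (w k) y < ε := hy.eventually (Metric.ball_mem_nhds y hε)
  obtain ⟨k, hk1, hk2⟩ := (e1.and e2).exists
  refine ⟨f k, w k, hf k, fun t => (hfh k t).trans ?_, ?_⟩
  · exact mul_le_mul_of_nonneg_right hk1.le (norm_nonneg t)
  · rw [dist_comm, dist_eq_norm] at hk2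
    exact hk2.le

/-- Every Krivine functional calculus is given by the limit procedure. -/
theorem lim_of_isKrivineCalculus {x : Fin n → X} {τ : HomogFun n →ₗ[ℝ] X}
    (hτ : IsKrivineCalculus x τ) (h : HomogFun n) : Lim x h (τ h) := by
  obtain ⟨N, hN⟩ := exists_rep_norm x
  have hmono : ∀ {a b : HomogFun n}, a ≤ b → τ a ≤ τ b := by
    intro a b hab
    rw [← sup_eq_right, ← hτ.map_sup, sup_eq_right.2 hab]
  intro ε hε
  have hδ : 0 < ε / (1 + ‖N‖) := by positivity
  obtain ⟨f, w, hf, hfh⟩ := exists_rep_near x h hδ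
  have hδε : ε / (1 + ‖N‖) ≤ ε := div_le_self hε.le (by linarith [norm_nonneg N])
  refine ⟨f, w, hf, fun t => (hfh t).trans (mul_le_mul_of_nonneg_right hδε (norm_nonneg t)), ?_⟩
  have hb : ‖τ h - w‖ ≤ ε / (1 + ‖N‖) * ‖N‖ := by
    refine norm_le_of_bounds hδ.le ?_ ?_
    · have hle : h - hf.toHomogFun ≤ (ε / (1 + ‖N‖)) • hN.toHomogFun :=
        (homogFun_le_iff.2 fun t => (le_abs_self _).trans (hfh t))
      simpa only [map_sub, map_smul, hf.map_eq hτ, hN.map_eq hτ] using hmono hle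
    · have hle : -(h - hf.toHomogFun) ≤ (ε / (1 + ‖N‖)) • hN.toHomogFun :=
        (homogFun_le_iff.2 fun t => (neg_le_abs _).trans (hfh t))
      simpa only [map_sub, map_neg, map_smul, hf.map_eq hτ, hN.map_eq hτ] using hmono hle
  refine hb.trans ?_
  rw [div_mul_eq_mul_div, div_le_iff₀ (by positivity)]
  exact mul_le_mul_of_nonneg_left (by linarith [norm_nonneg N]) hε.le

/-- **Krivine's functional calculus**: existence and uniqueness. -/
theorem existsUnique_isKrivineCalculus [CompleteSpace X] (x : Fin n → X) :
    ∃! τ : HomogFun n →ₗ[ℝ] X, IsKrivineCalculus x τ := by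
  choose T hT using exists_lim x
  refine ⟨{ toFun := T
            map_add' := fun h h' => (hT _).unique ((hT h).add (hT h'))
            map_smul' := fun c h => (hT _).unique ((hT h).smul c) }, ⟨?_, ?_⟩, ?_⟩
  · intro j
    exact (hT _).unique (Rep.lim (h := HomogFun.proj j) (Rep.coord x j))
  · intro h h'
    exact (hT _).unique ((hT h).sup (hT h'))
  · intro τ hτ
    ext h
    exact (lim_of_isKrivineCalculus hτ h).unique (hT h)

end Banach

end Krivine

section Calculus

variable {X : Type*} [NormedAddCommGroup X] [NormedSpace ℝ X] [CompleteSpace X] [Lattice X]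
  [HasSolidNorm X] [IsOrderedAddMonoid X] [IsOrderedModule ℝ X]

/-- The Krivine functional calculus `τ_{n,x} : 𝓗ₙ → X` at `x ∈ Xⁿ`, for a Banach lattice `X`:
the unique linear map that sends the `j`-th projection to `xⱼ` and preserves finite suprema. -/
noncomputable def krivineCalculus {n : ℕ} (x : Fin n → X) : HomogFun n →ₗ[ℝ] X :=
  (Krivine.existsUnique_isKrivineCalculus x).choose

theorem krivineCalculus_spec {n : ℕ} (x : Fin n → X) :
    IsKrivineCalculus x (krivineCalculus x) :=
  (Krivine.existsUnique_isKrivineCalculus x).choose_spec.1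

theorem eq_krivineCalculus {n : ℕ} {x : Fin n → X} {τ : HomogFun n →ₗ[ℝ] X}
    (hτ : IsKrivineCalculus x τ) : τ = krivineCalculus x :=
  (Krivine.existsUnique_isKrivineCalculus x).choose_spec.2 τ hτ

end Calculus

/-! ### Banach sequence lattices -/

/-- A Banach sequence lattice: an ideal `Y` of the space of all real sequences, with a complete
order-preserving norm, that contains every canonical sequence `eₖ`. -/
structure BanachSequenceLattice where
  /-- The underlying space of sequences. -/
  space : Submodule ℝ (ℕ → ℝ)
  /-- The norm of `Y`. -/
  norm : Seminorm ℝ space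
  eq_zero_of_norm_eq_zero : ∀ f, norm f = 0 → f = 0
  complete : ∀ u : ℕ → space,
    (∀ ε > 0, ∃ N, ∀ k ≥ N, ∀ m ≥ N, norm (u k - u m) < ε) →
      ∃ f, Tendsto (fun k => norm (u k - f)) atTop (𝓝 0)
  mem_of_abs_le : ∀ (f : ℕ → ℝ) (g : space), (∀ k, |f k| ≤ |g.1 k|) → f ∈ space
  norm_le_of_abs_le : ∀ f g : space, (∀ k, |f.1 k| ≤ |g.1 k|) → norm f ≤ norm g
  single_mem : ∀ k, Pi.single k 1 ∈ space

namespace BanachSequenceLattice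

variable (Y : BanachSequenceLattice)

/-- The sequence `(t₁, …, tₙ, 0, 0, …)`, as a linear function of `t ∈ ℝⁿ`. -/
def extend (n : ℕ) : (Fin n → ℝ) →ₗ[ℝ] (ℕ → ℝ) where
  toFun t k := if h : k < n then t ⟨k, h⟩ else 0
  map_add' := by
    intro s t
    ext k
    by_cases h : k < n <;> simp [h]
  map_smul' := by
    intro c t
    ext k
    by_cases h : k < n <;> simp [h]

theorem extend_mem {n : ℕ} (t : Fin n → ℝ) : extend n t ∈ Y.space := by
  have : extend n t = ∑ j : Fin n, t j • (Pi.single (j : ℕ) 1 : ℕ → ℝ) := by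
    ext k
    rw [Finset.sum_apply]
    by_cases h : k < n
    · rw [Finset.sum_eq_single (⟨k, h⟩ : Fin n)]
      · simp [extend, h]
      · intro j _ hj
        have : k ≠ (j : ℕ) := fun e => hj (Fin.ext e.symm)
        simp [this]
      · simp
    · rw [Finset.sum_eq_zero]
      · simp [extend, h]
      · intro j _
        have : k ≠ (j : ℕ) := fun e => h (e ▸ j.2)
        simp [this]
  rw [this]
  exact Y.space.sum_mem fun j _ => Y.space.smul_mem _ (Y.single_mem j)

/-- The norm `‖·‖_{ℝⁿ,Y}` on `ℝⁿ`: `‖(t₁, …, tₙ)‖_Y = ‖(t₁, …, tₙ, 0, 0, …)‖_Y`. -/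
def finNorm (n : ℕ) : Seminorm ℝ (Fin n → ℝ) :=
  Y.norm.comp ((extend n).codRestrict Y.space Y.extend_mem)

theorem continuous_finNorm (n : ℕ) : Continuous (Y.finNorm n) :=
  continuousOn_univ.1 ((Y.finNorm n).convexOn.continuousOn isOpen_univ)

/-- `‖·‖_{ℝⁿ,Y}` as an element of `𝓗ₙ`. -/
def finNormHomog (n : ℕ) : HomogFun n :=
  ⟨⟨Y.finNorm n, Y.continuous_finNorm n⟩, by
    intro c hc t
    simp [map_smul_eq_mul, abs_of_nonneg hc]⟩

/-- `‖(w₁, …, wₙ)‖_{Eⁿ,Y} = ‖(‖w₁‖, …, ‖wₙ‖)‖_Y` for vectors of a normed space `E`. -/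
def vecNorm {E : Type*} [NormedAddCommGroup E] {n : ℕ} (w : Fin n → E) : ℝ :=
  Y.finNorm n fun j => ‖w j‖

section Lattice

variable {X : Type*} [NormedAddCommGroup X] [NormedSpace ℝ X] [CompleteSpace X] [Lattice X]
  [HasSolidNorm X] [IsOrderedAddMonoid X] [IsOrderedModule ℝ X]

/-- `‖(x₁, …, xₙ)‖_Y = τ_{n,x} (‖·‖_{ℝⁿ,Y}) ∈ X`. -/
noncomputable def latticeVal {n : ℕ} (x : Fin n → X) : X :=
  krivineCalculus x (Y.finNormHomog n)

/-- `‖(x₁, …, xₙ)‖_{Xⁿ,Y,τ} = ‖ ‖(x₁, …, xₙ)‖_Y ‖_X`. -/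
noncomputable def latticeNorm {n : ℕ} (x : Fin n → X) : ℝ :=
  ‖Y.latticeVal x‖

end Lattice

end BanachSequenceLattice

/-! ### `Y`-convex, `Y`-concave and `Y`-regular operators -/

section Operators

variable (Y : BanachSequenceLattice)
  {E : Type*} [NormedAddCommGroup E] [NormedSpace ℝ E]
  {X : Type*} [NormedAddCommGroup X] [NormedSpace ℝ X] [CompleteSpace X] [Lattice X]
  [HasSolidNorm X] [IsOrderedAddMonoid X] [IsOrderedModule ℝ X]
  {W : Type*} [NormedAddCommGroup W] [NormedSpace ℝ W] [CompleteSpace W] [Lattice W]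
  [HasSolidNorm W] [IsOrderedAddMonoid W] [IsOrderedModule ℝ W]

/-- `‖(T w₁, …, T wₙ)‖_{Xⁿ,Y,τ} ≤ C ‖(w₁, …, wₙ)‖_{Eⁿ,Y}` for all `n` and all `wⱼ ∈ E`. -/
def YConvexBound (T : E →ₗ[ℝ] X) (C : ℝ) : Prop :=
  ∀ (n : ℕ) (w : Fin n → E), Y.latticeNorm (fun j => T (w j)) ≤ C * Y.vecNorm w

/-- `T : E → X` is `Y`-convex, i.e. `T ∈ 𝓚^Y(E, X)`. -/
def IsYConvex (T : E →ₗ[ℝ] X) : Prop :=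
  ∃ C > 0, YConvexBound Y T C

/-- The `Y`-convexity constant `‖T‖_{𝓚^Y}`: the smallest `C ≥ 0` in the inequality. -/
noncomputable def yConvexNorm (T : E →ₗ[ℝ] X) : ℝ :=
  sInf {C : ℝ | 0 ≤ C ∧ YConvexBound Y T C}

/-- `‖(S x₁, …, S xₙ)‖_{Eⁿ,Y} ≤ K ‖(x₁, …, xₙ)‖_{Xⁿ,Y,τ}` for all `n` and all `xⱼ ∈ X`. -/
def YConcaveBound (S : X →ₗ[ℝ] E) (K : ℝ) : Prop :=
  ∀ (n : ℕ) (x : Fin n → X), Y.vecNorm (fun j => S (x j)) ≤ K * Y.latticeNorm x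

/-- `S : X → E` is `Y`-concave, i.e. `S ∈ 𝓚_Y(X, E)`. -/
def IsYConcave (S : X →ₗ[ℝ] E) : Prop :=
  ∃ K > 0, YConcaveBound Y S K

/-- The `Y`-concavity constant `‖S‖_{𝓚_Y}`: the smallest `K ≥ 0` in the inequality. -/
noncomputable def yConcaveNorm (S : X →ₗ[ℝ] E) : ℝ :=
  sInf {K : ℝ | 0 ≤ K ∧ YConcaveBound Y S K}

/-- `‖(L x₁, …, L xₙ)‖_{Wⁿ,Y,τ} ≤ C ‖(x₁, …, xₙ)‖_{Xⁿ,Y,τ}` for all `n` and all `xⱼ ∈ X`. -/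
def YRegularBound (L : X →ₗ[ℝ] W) (C : ℝ) : Prop :=
  ∀ (n : ℕ) (x : Fin n → X), Y.latticeNorm (fun j => L (x j)) ≤ C * Y.latticeNorm x

/-- `L : X → W` is `Y`-regular, i.e. `L ∈ Λ_Y(X, W)`. -/
def IsYRegular (L : X →ₗ[ℝ] W) : Prop :=
  ∃ C > 0, YRegularBound Y L C

/-- The norm `‖L‖_{Λ_Y}`: the smallest `C ≥ 0` in the inequality. -/
noncomputable def yRegularNorm (L : X →ₗ[ℝ] W) : ℝ :=
  sInf {C : ℝ | 0 ≤ C ∧ YRegularBound Y L C}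

end Operators

/-! Each of the three classes is defined by comparing two norms of tuples, uniformly in the length
of the tuple, and a composite operator acts on a tuple coordinate by coordinate. So the inequality
of the outer operator, taken at the image tuple under the inner one, chains with the inequality of
the inner operator, and the constants multiply. Krivine's calculus enters only through the number
`latticeNorm`; of that number nothing but nonnegativity is needed.

Two points remain. First, (i) and (iii) involve a bounded operator between Banach spaces, which must
be shown to act on tuples with the `Y`-norm with constant `‖R‖`. This is `vecNorm_comp_le`, and it
comes from the lattice property of the norm of `Y`. Second, the constants are infima, so chaining
them directly requires that the infima be admissible themselves. This is `sInf_mem_bounds`: the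
admissible constants form a closed set. -/

namespace BanachSequenceLattice

variable (Y : BanachSequenceLattice)

theorem finNorm_mono {n : ℕ} {s t : Fin n → ℝ} (h : ∀ j, |s j| ≤ |t j|) :
    Y.finNorm n s ≤ Y.finNorm n t := by
  refine Y.norm_le_of_abs_le _ _ fun k => ?_
  by_cases hk : k < n
  · simpa [extend, hk] using h ⟨k, hk⟩
  -- Beyond the first `n` places both sequences vanish.
  · simp [extend, hk]

theorem vecNorm_nonneg {E : Type*} [NormedAddCommGroup E] {n : ℕ} (w : Fin n → E) :
    0 ≤ Y.vecNorm w :=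
  apply_nonneg _ _

/-- The tuple of norms of the images is dominated, coordinate by coordinate, by `‖R‖` times the
tuple of norms. A lattice norm respects this domination, and homogeneity takes the factor out. The
constant therefore does not depend on `n` or on `Y`. -/
theorem vecNorm_comp_le {E F : Type*} [NormedAddCommGroup E] [NormedSpace ℝ E]
    [NormedAddCommGroup F] [NormedSpace ℝ F] (R : F →L[ℝ] E) {n : ℕ} (w : Fin n → F) :
    Y.vecNorm (fun j => R (w j)) ≤ ‖R‖ * Y.vecNorm w := by
  have h : Y.vecNorm (fun j => R (w j)) ≤ Y.finNorm n (‖R‖ • fun j => ‖w j‖) := by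
    refine Y.finNorm_mono fun j => ?_
    simpa [abs_mul] using R.le_opNorm (w j)
  simpa [vecNorm, map_smul_eq_mul] using h

end BanachSequenceLattice

/-- Each single inequality is a closed condition on `C`, so the admissible constants form a closed
set that is bounded below, and such a set contains its infimum once it is nonempty. This justifies
calling the infimum the smallest constant. The two-level index stands for a length `n` and a tuple
of that length, so one statement serves convexity, concavity and regularity. -/
theorem sInf_mem_bounds {ι : Type*} {κ : ι → Type*} {a b : ∀ i, κ i → ℝ}
    (h : ∃ C > 0, ∀ i k, a i k ≤ C * b i k) :
    0 ≤ sInf {C : ℝ | 0 ≤ C ∧ ∀ i k, a i k ≤ C * b i k} ∧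
      ∀ i k, a i k ≤ sInf {C : ℝ | 0 ≤ C ∧ ∀ i k, a i k ≤ C * b i k} * b i k := by
  have hclosed : IsClosed {C : ℝ | 0 ≤ C ∧ ∀ i k, a i k ≤ C * b i k} := by
    simp only [Set.ofPred_and, Set.ofPred_forall]
    exact isClosed_Ici.inter (isClosed_iInter fun i => isClosed_iInter fun k =>
      isClosed_le (by fun_prop) (by fun_prop))
  obtain ⟨C, hC, hb⟩ := h
  -- Nonemptiness matters: the real infimum of the empty set is `0` by convention, which need not be
  -- an admissible constant.
  exact hclosed.csInf_mem ⟨C, hC.le, hb⟩ ⟨0, fun _ h => h.1⟩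

/-! ### Optimal constants of convex, concave and regular operators -/

section Operators

variable {Y : BanachSequenceLattice}
  {E : Type*} [NormedAddCommGroup E] [NormedSpace ℝ E]
  {X : Type*} [NormedAddCommGroup X] [NormedSpace ℝ X] [CompleteSpace X] [Lattice X]
  [HasSolidNorm X] [IsOrderedAddMonoid X] [IsOrderedModule ℝ X]
  {W : Type*} [NormedAddCommGroup W] [NormedSpace ℝ W] [CompleteSpace W] [Lattice W]
  [HasSolidNorm W] [IsOrderedAddMonoid W] [IsOrderedModule ℝ W]

theorem IsYConvex.norm_spec {T : E →ₗ[ℝ] X} (hT : IsYConvex Y T) :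
    0 ≤ yConvexNorm Y T ∧ YConvexBound Y T (yConvexNorm Y T) :=
  sInf_mem_bounds (κ := fun n => Fin n → E)
    (a := fun _ w => Y.latticeNorm fun j => T (w j)) (b := fun _ w => Y.vecNorm w) hT

theorem IsYConcave.norm_spec {S : X →ₗ[ℝ] E} (hS : IsYConcave Y S) :
    0 ≤ yConcaveNorm Y S ∧ YConcaveBound Y S (yConcaveNorm Y S) :=
  sInf_mem_bounds (κ := fun n => Fin n → X)
    (a := fun _ w => Y.vecNorm fun j => S (w j)) (b := fun _ w => Y.latticeNorm w) hS

theorem IsYRegular.norm_spec {L : X →ₗ[ℝ] W} (hL : IsYRegular Y L) :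
    0 ≤ yRegularNorm Y L ∧ YRegularBound Y L (yRegularNorm Y L) :=
  sInf_mem_bounds (κ := fun n => Fin n → X)
    (a := fun _ w => Y.latticeNorm fun j => L (w j)) (b := fun _ w => Y.latticeNorm w) hL

/-- One inequality with an explicit constant yields both membership in the class and the estimate of
its norm, which are the two claims made about each composite. -/
theorem YConvexBound.isYConvex_and_norm_le {T : E →ₗ[ℝ] X} {C : ℝ} (hT : YConvexBound Y T C)
    (hC : 0 ≤ C) : IsYConvex Y T ∧ yConvexNorm Y T ≤ C :=
  -- Membership asks for a strictly positive constant while `C` may be `0`, hence `C + 1`; the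
  -- infimum ranges over `C ≥ 0`, so there `C` itself is used.
  ⟨⟨C + 1, by positivity, fun n w => (hT n w).trans
    (mul_le_mul_of_nonneg_right (by linarith) (Y.vecNorm_nonneg w))⟩,
    csInf_le ⟨0, fun _ h => h.1⟩ ⟨hC, hT⟩⟩

theorem YConcaveBound.isYConcave_and_norm_le {S : X →ₗ[ℝ] E} {C : ℝ} (hS : YConcaveBound Y S C)
    (hC : 0 ≤ C) : IsYConcave Y S ∧ yConcaveNorm Y S ≤ C :=
  ⟨⟨C + 1, by positivity, fun n x => (hS n x).trans
    (mul_le_mul_of_nonneg_right (by linarith) (norm_nonneg _))⟩,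
    csInf_le ⟨0, fun _ h => h.1⟩ ⟨hC, hS⟩⟩

end Operators

/-! ### Stability under composition -/

theorem mainTheorem6
    (Y : BanachSequenceLattice)
    {E : Type*} [NormedAddCommGroup E] [NormedSpace ℝ E] [CompleteSpace E]
    {F : Type*} [NormedAddCommGroup F] [NormedSpace ℝ F] [CompleteSpace F]
    {X : Type*} [NormedAddCommGroup X] [NormedSpace ℝ X] [CompleteSpace X] [Lattice X]
    [HasSolidNorm X] [IsOrderedAddMonoid X] [IsOrderedModule ℝ X]
    {W : Type*} [NormedAddCommGroup W] [NormedSpace ℝ W] [CompleteSpace W] [Lattice W]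
    [HasSolidNorm W] [IsOrderedAddMonoid W] [IsOrderedModule ℝ W] :
    (∀ (R : F →L[ℝ] E) (T : E →ₗ[ℝ] X), IsYConvex Y T →
      IsYConvex Y (T ∘ₗ (R : F →ₗ[ℝ] E)) ∧
        yConvexNorm Y (T ∘ₗ (R : F →ₗ[ℝ] E)) ≤ yConvexNorm Y T * ‖R‖) ∧
    (∀ (T : E →ₗ[ℝ] X) (L : X →ₗ[ℝ] W), IsYConvex Y T → IsYRegular Y L →
      IsYConvex Y (L ∘ₗ T) ∧
        yConvexNorm Y (L ∘ₗ T) ≤ yRegularNorm Y L * yConvexNorm Y T) ∧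
    (∀ (S : X →ₗ[ℝ] E) (R : E →L[ℝ] F), IsYConcave Y S →
      IsYConcave Y ((R : E →ₗ[ℝ] F) ∘ₗ S) ∧
        yConcaveNorm Y ((R : E →ₗ[ℝ] F) ∘ₗ S) ≤ ‖R‖ * yConcaveNorm Y S) ∧
    (∀ (L : X →ₗ[ℝ] W) (S : W →ₗ[ℝ] E), IsYRegular Y L → IsYConcave Y S →
      IsYConcave Y (S ∘ₗ L) ∧
        yConcaveNorm Y (S ∘ₗ L) ≤ yConcaveNorm Y S * yRegularNorm Y L) := by
  refine ⟨fun R T hT => ?_, fun T L hT hL => ?_, fun S R hS => ?_, fun L S hL hS => ?_⟩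
  · obtain ⟨h0, hb⟩ := hT.norm_spec
    refine YConvexBound.isYConvex_and_norm_le (fun n w => ?_) (mul_nonneg h0 (norm_nonneg R))
    rw [mul_assoc]
    -- Convexity of `T` at the tuple `R (w j)`, then the bound for `R` on tuples.
    exact (hb n fun j => R (w j)).trans (mul_le_mul_of_nonneg_left (Y.vecNorm_comp_le R w) h0)
  · obtain ⟨hT0, hTb⟩ := hT.norm_spec
    obtain ⟨hL0, hLb⟩ := hL.norm_spec
    refine YConvexBound.isYConvex_and_norm_le (fun n w => ?_) (mul_nonneg hL0 hT0)
    rw [mul_assoc]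
    -- Regularity of `L` is applied at a tuple in the range of `T`; its right-hand side is exactly
    -- what convexity of `T` controls.
    exact (hLb n fun j => T (w j)).trans (mul_le_mul_of_nonneg_left (hTb n w) hL0)
  · obtain ⟨h0, hb⟩ := hS.norm_spec
    refine YConcaveBound.isYConcave_and_norm_le (fun n x => ?_) (mul_nonneg (norm_nonneg R) h0)
    rw [mul_assoc]
    -- Here `R` is the outer operator, so its bound on tuples comes first.
    exact (Y.vecNorm_comp_le R fun j => S (x j)).trans
      (mul_le_mul_of_nonneg_left (hb n x) (norm_nonneg R))
  · obtain ⟨hL0, hLb⟩ := hL.norm_spec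
    obtain ⟨hS0, hSb⟩ := hS.norm_spec
    refine YConcaveBound.isYConcave_and_norm_le (fun n x => ?_) (mul_nonneg hS0 hL0)
    rw [mul_assoc]
    -- The lattice norm of the tuple `L (x j)` in `W` is the link: it bounds the left side by
    -- concavity of `S` and is bounded by regularity of `L`.
    exact (hSb n fun j => L (x j)).trans (mul_le_mul_of_nonneg_left (hLb n x) hS0)
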